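/- Conventions. All categories and functors below are $\mathbb{C}$-linear. A fusion category is a $\mathbb{C}$-linear semisimple abelian rigid monoidal category (with bilinear tensor product) that has finitely many isomorphism classes of simple objects, whose unit object $\mathbf 1$ is simple, and such that $\operatorname{End}(V)\cong\mathbb{C}$ for every simple object $V$. We write $b_V:\mathbf 1\to V\otimes V^*$ and $d_V:V^*\otimes V\to\mathbf 1$ for the duality morphisms, and suppress unit constraints. A pivotal structure is an isomorphism $j:\mathrm{id}\to(-)^{**}$ of monoidal functors; a pivotal fusion category is a fusion category with a chosen pivotal structure. The pivotal dimension of $V$ is $\operatorname{pdim}(V)=d_{V^*}\circ(j_V\otimes\mathrm{id}_{V^*})\circ b_V\in\operatorname{End}(\mathbf 1)\cong\mathbb{C}$. Put $V^{\otimes 0}=\mathbf 1$ and $V^{\otimes n}=V\otimes V^{\otimes(n-1)}$. For $n\ge 1$, the $n$-th Frobenius–Schur indicator $\nu_n(V)$ is the trace of the linear map $$E_V^{(n)}:\operatorname{Hom}(\mathbf 1,V^{\otimes n})\to\operatorname{Hom}(\mathbf 1,V^{\otimes n}),\qquad f\mapsto a_V^{(n)}\circ(\mathrm{id}_{V^{\otimes(n-1)}}\otimes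 j_V^{-1})\circ D(f),$$ where $D:\operatorname{Hom}(\mathbf 1,V\otimes W)\to\operatorname{Hom}(V^*,W)\to\operatorname{Hom}(\mathbf 1,W\otimes V^{**})$ with $W=V^{\otimes(n-1)}$ is the composite of the two duality isomorphisms given by $d_V$ and $b_{V^*}$, and $a_V^{(n)}:V^{\otimes(n-1)}\otimes V\to V^{\otimes n}$ is the canonical associativity isomorphism. Finally, for a pivotal fusion category $\mathcal C$, $$\nu_n(\mathcal C)=\sum_{V\in\operatorname{Irr}(\mathcal C)}\nu_n(V)\operatorname{pdim}(V)\qquad(n\ge 1),$$ where $\operatorname{Irr}(\mathcal C)$ is a set of representatives of the isomorphism classes of simple objects. Theorem. Let $\mathcal C$ and $\mathcal D$ be pivotal fusion categories. If there is a ($\mathbb{C}$-linear, strong) monoidal functor $\mathcal C\to\mathcal D$ that is an equivalence of categories (not assumed to be compatible with the pivotal structures), then $\nu_n(\mathcal C)=\nu_n(\mathcal D)$ for every integer $n\ge 1$. -/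

import Mathlib

open CategoryTheory MonoidalCategory

namespace FusionFS

universe v u v₁ u₁ v₂ u₂

noncomputable section

section Duality

variable {C : Type u} [Category.{v} C] [MonoidalCategory C] [RightRigidCategory C]

/-- The chosen dual `V*` of `V`, with coevaluation `𝟙 ⟶ V ⊗ V*` and evaluation `V* ⊗ V ⟶ 𝟙`.
An object with these morphisms is called a left dual by some authors and a right dual in Mathlib. -/
abbrev dual (V : C) : C := Vᘁ

/-- The coevaluation `b_V : 𝟙 ⟶ V ⊗ V*`. -/
abbrev coev (V : C) : 𝟙_ C ⟶ V ⊗ dual V := η_ V Vᘁ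

/-- The evaluation `d_V : V* ⊗ V ⟶ 𝟙`. -/
abbrev ev (V : C) : dual V ⊗ V ⟶ 𝟙_ C := ε_ V Vᘁ

/-- The transpose `f* : W* ⟶ V*` of a morphism `f : V ⟶ W`. -/
abbrev dualMap {V W : C} (f : V ⟶ W) : dual W ⟶ dual V := fᘁ

/-- The canonical isomorphism `(V ⊗ W)* ≅ W* ⊗ V*`. -/
def dualTensorIso (V W : C) : dual (V ⊗ W) ≅ dual W ⊗ dual V :=
  rightDualIso (RightRigidCategory.rightDual (V ⊗ W)).exact ExactPairing.tensor

variable (C) in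
/-- The canonical isomorphism `𝟙* ≅ 𝟙`. -/
def dualUnitIso : dual (𝟙_ C) ≅ 𝟙_ C :=
  rightDualIso (RightRigidCategory.rightDual (𝟙_ C)).exact exactPairingUnit

variable (C) in
/-- The double dual functor `(-)** : C ⥤ C`. -/
@[simps]
def doubleDual : C ⥤ C where
  obj V := dual (dual V)
  map f := dualMap (dualMap f)
  map_id V := by simp [dualMap]
  map_comp f g := by simp [dualMap, comp_rightAdjointMate]

/-- The tensor structure `V** ⊗ W** ⟶ (V ⊗ W)**` of the double dual functor. -/
def doubleDualTensor (V W : C) :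
    dual (dual V) ⊗ dual (dual W) ⟶ dual (dual (V ⊗ W)) :=
  (dualTensorIso (dual W) (dual V)).inv ≫ dualMap (dualTensorIso V W).hom

variable (C) in
/-- The unit structure `𝟙 ⟶ 𝟙**` of the double dual functor. -/
def doubleDualUnit : 𝟙_ C ⟶ dual (dual (𝟙_ C)) :=
  (dualUnitIso C).inv ≫ dualMap (dualUnitIso C).hom

variable (C) in
/-- A pivotal structure: an isomorphism of monoidal functors from the identity functor to the
double dual functor. -/
structure PivotalStructure where
  /-- The underlying natural isomorphism `j_V : V ≅ V**`. -/
  iso : 𝟭 C ≅ doubleDual C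
  /-- Compatibility with the tensor product: `j_{V ⊗ W}` is `j_V ⊗ j_W` up to the canonical
  isomorphism. -/
  tensor : ∀ V W : C, iso.hom.app (V ⊗ W) =
    (iso.hom.app V ⊗ₘ iso.hom.app W) ≫ doubleDualTensor V W
  /-- Compatibility with the unit object. -/
  unit : iso.hom.app (𝟙_ C) = doubleDualUnit C

/-- The component `j_V : V ≅ V**` of a pivotal structure. -/
def PivotalStructure.app (j : PivotalStructure C) (V : C) : V ≅ dual (dual V) := j.iso.app V

/-- The trace of `f : V ⟶ V**`, the endomorphism `d_{V*} ∘ (f ⊗ id_{V*}) ∘ b_V` of `𝟙`. -/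
def ctrace {V : C} (f : V ⟶ dual (dual V)) : End (𝟙_ C) :=
  coev V ≫ f ▷ dual V ≫ ev (dual V)

/-- The tensor power: `V^{⊗0} = 𝟙` and `V^{⊗(n+1)} = V ⊗ V^{⊗n}`. -/
def tensorPow (V : C) : ℕ → C
  | 0 => 𝟙_ C
  | n + 1 => V ⊗ tensorPow V n

/-- The isomorphism `a_V^{(n+1)} : V^{⊗n} ⊗ V ≅ V^{⊗(n+1)}` composed of associativity (and unit)
constraints. -/
def tensorPowShift (V : C) : (n : ℕ) → (tensorPow V n ⊗ V ≅ V ⊗ tensorPow V n)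
  | 0 => λ_ V ≪≫ (ρ_ V).symm
  | n + 1 => α_ V (tensorPow V n) V ≪≫ whiskerLeftIso V (tensorPowShift V n)

/-- The map `A : Hom(X, Y ⊗ Z) → Hom(Y* ⊗ X, Z)`, `f ↦ (d_Y ⊗ id_Z) ∘ a⁻¹ ∘ (id_{Y*} ⊗ f)`. -/
def homA {X Y Z : C} (f : X ⟶ Y ⊗ Z) : dual Y ⊗ X ⟶ Z :=
  dual Y ◁ f ≫ (α_ (dual Y) Y Z).inv ≫ ev Y ▷ Z ≫ (λ_ Z).hom

/-- The map `B : Hom(X ⊗ Y, Z) → Hom(X, Z ⊗ Y*)`, `f ↦ (f ⊗ id_{Y*}) ∘ a⁻¹ ∘ (id_X ⊗ b_Y)`. -/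
def homB {X Y Z : C} (f : X ⊗ Y ⟶ Z) : X ⟶ Z ⊗ dual Y :=
  (ρ_ X).inv ≫ X ◁ coev Y ≫ (α_ X Y (dual Y)).inv ≫ f ▷ dual Y

/-- The map `D_{V,W} : Hom(𝟙, V ⊗ W) → Hom(𝟙, W ⊗ V**)`, the composite of `B` and `A` (with the
unit constraints that identify `V* ⊗ 𝟙` and `𝟙 ⊗ V*`). -/
def homD {V W : C} (f : 𝟙_ C ⟶ V ⊗ W) : 𝟙_ C ⟶ W ⊗ dual (dual V) :=
  homB ((λ_ (dual V)).hom ≫ (ρ_ (dual V)).inv ≫ homA f)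

variable [Preadditive C] [MonoidalPreadditive C]

theorem homD_add {V W : C} (f g : 𝟙_ C ⟶ V ⊗ W) : homD (f + g) = homD f + homD g := by
  simp only [homD, homA, homB, MonoidalPreadditive.whiskerLeft_add,
    MonoidalPreadditive.add_whiskerRight, Preadditive.add_comp, Preadditive.comp_add]

variable [Linear ℂ C] [MonoidalLinear ℂ C]

theorem homD_smul {V W : C} (c : ℂ) (f : 𝟙_ C ⟶ V ⊗ W) : homD (c • f) = c • homD f := by
  simp only [homD, homA, homB, MonoidalLinear.whiskerLeft_smul,
    MonoidalLinear.smul_whiskerRight, Linear.smul_comp, Linear.comp_smul]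

/-- The endomorphism `E_V^{(n)}` of `Hom(𝟙, V^{⊗n})`, here with `n = m + 1`,
so that `V^{⊗n} = V ⊗ V^{⊗m}`: `f ↦ a_V^{(n)} ∘ (id ⊗ j_V⁻¹) ∘ D(f)`. -/
def rotation (j : PivotalStructure C) (V : C) (m : ℕ) :
    (𝟙_ C ⟶ V ⊗ tensorPow V m) →ₗ[ℂ] (𝟙_ C ⟶ V ⊗ tensorPow V m) where
  toFun f := homD f ≫ tensorPow V m ◁ (j.app V).inv ≫ (tensorPowShift V m).hom
  map_add' f g := by rw [homD_add, Preadditive.add_comp]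
  map_smul' c f := by rw [homD_smul, Linear.smul_comp, RingHom.id_apply]

/-- The `n`-th Frobenius–Schur indicator `ν_n(V) = Tr(E_V^{(n)})`, for `n ≥ 1` (`n.natPred` is
`n - 1`). -/
def indicator (j : PivotalStructure C) (n : ℕ+) (V : C) : ℂ :=
  LinearMap.trace ℂ (𝟙_ C ⟶ V ⊗ tensorPow V n.natPred) (rotation j V n.natPred)

end Duality

section Fusion

/-- The set of isomorphism classes of simple objects. Whether the representative `c.out` is simple
does not depend on the representative. -/
abbrev Irr (C : Type u) [Category.{v} C] [Abelian C] : Type u :=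
  {c : Quotient (isIsomorphicSetoid C) // Simple c.out}

/-- A representative of an isomorphism class of simple objects. -/
def Irr.rep {C : Type u} [Category.{v} C] [Abelian C] (c : Irr C) : C := c.1.out

attribute [local instance] Abelian.hasFiniteBiproducts

/-- A fusion category over `ℂ`: a `ℂ`-linear semisimple (abelian, every object a finite direct sum
of simple objects) rigid monoidal category with finitely many isomorphism classes of simple
objects, with simple unit object, and with `End(V) ≅ ℂ` for every simple object `V`. -/
class FusionCategory (C : Type u) [Category.{v} C] [Abelian C] [Linear ℂ C] [MonoidalCategory C]
    [MonoidalPreadditive C] [MonoidalLinear ℂ C] [RigidCategory C] : Prop where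
  semisimple : ∀ X : C, ∃ (n : ℕ) (S : Fin n → C), (∀ i, Simple (S i)) ∧ Nonempty (X ≅ ⨁ S)
  finite_simple : Finite (Irr C)
  simple_unit : Simple (𝟙_ C)
  end_simple : ∀ V : C, Simple V → Nonempty (End V ≃ₐ[ℂ] ℂ)

variable {C : Type u} [Category.{v} C] [Abelian C] [Linear ℂ C] [MonoidalCategory C]
  [MonoidalPreadditive C] [MonoidalLinear ℂ C] [RigidCategory C] [FusionCategory C]

/-- An endomorphism of the unit object, regarded as a complex number through the (unique)
isomorphism of algebras `End(𝟙) ≅ ℂ`. -/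
def unitScalar (f : End (𝟙_ C)) : ℂ :=
  (FusionCategory.end_simple (𝟙_ C) FusionCategory.simple_unit).some f

/-- The pivotal trace of `f : V ⟶ V`. -/
def ptrace (j : PivotalStructure C) {V : C} (f : V ⟶ V) : ℂ :=
  unitScalar (ctrace (f ≫ (j.app V).hom))

/-- The pivotal dimension of `V`. -/
def pdim (j : PivotalStructure C) (V : C) : ℂ := ptrace j (𝟙 V)

instance finite_irr : Finite (Irr C) := FusionCategory.finite_simple

/-- The `n`-th indicator `ν_n(C) = ∑_{V ∈ Irr(C)} ν_n(V) pdim(V)` of a pivotal fusion category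
(a finite sum). -/
def categoryIndicator (j : PivotalStructure C) (n : ℕ+) : ℂ :=
  ∑ᶠ c : Irr C, indicator j n c.rep * pdim j c.rep

end Fusion

/-- Two `ℂ`-linear monoidal categories are monoidally equivalent if there is a (strong) monoidal
`ℂ`-linear functor between them which is an equivalence of categories. -/
def MonoidallyEquivalent (C : Type u₁) [Category.{v₁} C] [Preadditive C] [Linear ℂ C]
    [MonoidalCategory C] (D : Type u₂) [Category.{v₂} D] [Preadditive D] [Linear ℂ D]
    [MonoidalCategory D] : Prop :=
  ∃ F : C ⥤ D, F.IsEquivalence ∧ F.Additive ∧ F.Linear ℂ ∧ Nonempty F.Monoidal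

end

end FusionFS

/-!
A summand `ν_n(V) pdim(V)` with `V` simple does not depend on the pivotal structure at all.
An isomorphism `φ : V ≅ V**` turns the pairing of `V*` with `V**` into a pairing of `V*` with `V`,
so it makes `X = V*` a dual of `V` on both sides. Given pairings `p` of `V` with `X` and `q` of `X`
with `V`, the rotation of `f : 𝟙 ⟶ V ⊗ W` creates `X ⊗ V` with the coevaluation of `q` and cancels
`X` against the first factor of `f` with the evaluation of `p`, while the pivotal dimension is the
coevaluation of `p` followed by the evaluation of `q`. Let `pairingIndicator p q` be the trace of
the rotation multiplied by this dimension.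

For simple `V` this number does not depend on `p`, `q` or even `X` (`pairingIndicator_eq`). Duals are
unique up to a compatible isomorphism, which reduces the question to two pairings of the same `X`
with `V`. By Schur's lemma they differ by a scalar `c`: the coevaluation is multiplied by `c` and
the evaluation by `c⁻¹`, so that the trace and the dimension change by inverse factors.

A monoidal equivalence `F` carries pairings to pairings and conjugates the rotation of `V` into that
of any `V' ≅ F V` (`trace_rotateEnd_map`), so it preserves `pairingIndicator`
(`pairingIndicator_map`), whatever the pivotal structures are. As `F` induces a bijection on
isomorphism classes of simple objects (`Irr.map_bijective`), the two sums agree term by term.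
-/

namespace FusionFS

open Functor.LaxMonoidal Functor.OplaxMonoidal

universe v u v₁ u₁ v₂ u₂

noncomputable section

/-! ### Exact pairings and the rotation of invariant vectors -/

section Pairings

variable {C : Type u} [Category.{v} C] [MonoidalCategory C]

theorem coevaluation_comp_rightDualIso {X Y₁ Y₂ : C} (p₁ : ExactPairing X Y₁)
    (p₂ : ExactPairing X Y₂) :
    p₁.coevaluation' ≫ X ◁ (rightDualIso p₁ p₂).hom = p₂.coevaluation' := by
  have h := @coevaluation_comp_rightAdjointMate C _ _ X X ⟨Y₂⟩ ⟨Y₁⟩ (𝟙 X)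
  rw [id_whiskerRight, Category.comp_id] at h
  exact h

theorem rightDualIso_comp_evaluation {X Y₁ Y₂ : C} (p₁ : ExactPairing X Y₁)
    (p₂ : ExactPairing X Y₂) :
    (rightDualIso p₁ p₂).hom ▷ X ≫ p₂.evaluation' = p₁.evaluation' := by
  have h := @rightAdjointMate_comp_evaluation C _ _ X X ⟨Y₂⟩ ⟨Y₁⟩ (𝟙 X)
  rw [MonoidalCategory.whiskerLeft_id, Category.id_comp] at h
  exact h

/-- The rotation of an invariant vector `f : 𝟙 ⟶ V ⊗ W` by a coevaluation `η : 𝟙 ⟶ X ⊗ V` and an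
evaluation `ε : X ⊗ V ⟶ 𝟙`, which need not be part of the same exact pairing: create `X ⊗ V`,
insert `f` between the two factors, and cancel `X` against the first factor of `f`. -/
def rotateHom {V X W : C} (η : 𝟙_ C ⟶ X ⊗ V) (ε : X ⊗ V ⟶ 𝟙_ C) (f : 𝟙_ C ⟶ V ⊗ W) :
    𝟙_ C ⟶ W ⊗ V :=
  η ≫ ((ρ_ X).inv ≫ X ◁ f ≫ (α_ X V W).inv ≫ ε ▷ W ≫ (λ_ W).hom) ▷ V

/-- An isomorphism `X ≅ X'` may be moved from the coevaluation to the evaluation. -/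
theorem rotateHom_congr {V X X' W : C} (γ : X ≅ X') (η : 𝟙_ C ⟶ X ⊗ V) (ε : X' ⊗ V ⟶ 𝟙_ C)
    (f : 𝟙_ C ⟶ V ⊗ W) :
    rotateHom (η ≫ γ.hom ▷ V) ε f = rotateHom η (γ.hom ▷ V ≫ ε) f := by
  simp only [rotateHom, Category.assoc, ← comp_whiskerRight]
  congr 2
  rw [rightUnitor_inv_naturality_assoc, ← whisker_exchange_assoc]
  simp

/-- Rotation is natural in both tensor factors. -/
theorem rotateHom_comp_tensorHom {V V' X W W' : C} (β : V ≅ V') (θ : W ⟶ W')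
    (η : 𝟙_ C ⟶ X ⊗ V) (ε : X ⊗ V ⟶ 𝟙_ C) (f : 𝟙_ C ⟶ V ⊗ W) :
    rotateHom (η ≫ X ◁ β.hom) (X ◁ β.inv ≫ ε) (f ≫ (β.hom ⊗ₘ θ)) =
      rotateHom η ε f ≫ (θ ⊗ₘ β.hom) := by
  have h : X ◁ V ◁ θ ≫ (α_ X V W').inv ≫ ε ▷ W' ≫ (λ_ W').hom =
      (α_ X V W).inv ≫ ε ▷ W ≫ (λ_ W).hom ≫ θ := by
    rw [associator_inv_naturality_right_assoc, whisker_exchange_assoc]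
    simp
  have h' : (ρ_ X).inv ≫ X ◁ (f ≫ (β.hom ⊗ₘ θ)) ≫ (α_ X V' W').inv ≫
      (X ◁ β.inv ≫ ε) ▷ W' ≫ (λ_ W').hom =
      ((ρ_ X).inv ≫ X ◁ f ≫ (α_ X V W).inv ≫ ε ▷ W ≫ (λ_ W).hom) ≫ θ := by
    simp only [Category.assoc, ← h]
    simp [MonoidalCategory.tensorHom_def']
  rw [rotateHom, h', Category.assoc, whisker_exchange, comp_whiskerRight, rotateHom,
    MonoidalCategory.tensorHom_def]
  simp only [Category.assoc]

/-- `D` followed by `φ⁻¹ : V** ⟶ V` is the rotation by the pairings of `V` with `V*` and, through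
`φ`, of `V*` with `V`. -/
theorem homD_comp_whiskerLeft [RightRigidCategory C] {V W : C} (φ : V ≅ dual (dual V))
    (f : 𝟙_ C ⟶ V ⊗ W) :
    homD f ≫ W ◁ φ.inv = rotateHom (coev (dual V) ≫ dual V ◁ φ.inv) (ev V) f := by
  simp only [homD, homA, homB, rotateHom, Category.assoc]
  rw [← whisker_exchange]
  simp [unitors_equal]

end Pairings

/-! ### Images under a monoidal functor -/

section Functor

variable {C : Type u₁} [Category.{v₁} C] [MonoidalCategory C]
  {D : Type u₂} [Category.{v₂} D] [MonoidalCategory D]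
  (F : C ⥤ D) [F.Monoidal]

/-- A monoidal functor carries exact pairings to exact pairings. -/
abbrev mapExactPairing {X Y : C} (p : ExactPairing X Y) : ExactPairing (F.obj X) (F.obj Y) where
  coevaluation' := ε F ≫ F.map p.coevaluation' ≫ δ F X Y
  evaluation' := μ F Y X ≫ F.map p.evaluation' ≫ η F
  coevaluation_evaluation' := by
    have h := congrArg F.map p.coevaluation_evaluation'
    simp only [Functor.map_comp, Functor.Monoidal.map_whiskerLeft,
      Functor.Monoidal.map_whiskerRight, Functor.Monoidal.map_associator_inv,
      Functor.Monoidal.map_leftUnitor_inv, Functor.Monoidal.map_rightUnitor] at h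
    rw [← cancel_epi (F.obj Y ◁ η F), ← cancel_epi (δ F Y (𝟙_ C)),
      ← cancel_mono (ε F ▷ F.obj Y), ← cancel_mono (μ F (𝟙_ C) Y)]
    simpa [-μ_natural_left, -μ_natural_right, -δ_natural_left, -δ_natural_right] using h
  evaluation_coevaluation' := by
    have h := congrArg F.map p.evaluation_coevaluation'
    simp only [Functor.map_comp, Functor.Monoidal.map_whiskerLeft,
      Functor.Monoidal.map_whiskerRight, Functor.Monoidal.map_associator,
      Functor.Monoidal.map_rightUnitor_inv, Functor.Monoidal.map_leftUnitor] at h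
    rw [← cancel_epi (η F ▷ F.obj X), ← cancel_epi (δ F (𝟙_ C) X),
      ← cancel_mono (F.obj X ◁ ε F), ← cancel_mono (μ F X (𝟙_ C))]
    simpa [-μ_natural_left, -μ_natural_right, -δ_natural_left, -δ_natural_right] using h

theorem map_rotateHom {V X W : C} (c : 𝟙_ C ⟶ X ⊗ V) (e : X ⊗ V ⟶ 𝟙_ C) (f : 𝟙_ C ⟶ V ⊗ W) :
    rotateHom (ε F ≫ F.map c ≫ δ F X V) (μ F X V ≫ F.map e ≫ η F) (ε F ≫ F.map f ≫ δ F V W) =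
      ε F ≫ F.map (rotateHom c e f) ≫ δ F W V := by
  have h : (ρ_ (F.obj X)).inv ≫ F.obj X ◁ (ε F ≫ F.map f ≫ δ F V W) ≫
      (α_ _ _ _).inv ≫ (μ F X V ≫ F.map e ≫ η F) ▷ F.obj W ≫ (λ_ _).hom =
      F.map ((ρ_ X).inv ≫ X ◁ f ≫ (α_ X V W).inv ≫ e ▷ W ≫ (λ_ W).hom) := by
    simp only [Functor.map_comp, Functor.Monoidal.map_whiskerLeft,
      Functor.Monoidal.map_whiskerRight, Functor.Monoidal.map_associator_inv,
      Functor.Monoidal.map_rightUnitor_inv, Functor.Monoidal.map_leftUnitor, Category.assoc,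
      MonoidalCategory.whiskerLeft_comp, comp_whiskerRight, Functor.Monoidal.μ_δ_assoc]
  rw [rotateHom, h, rotateHom, Functor.map_comp _ c, Functor.Monoidal.map_whiskerRight]
  simp only [Category.assoc, Functor.Monoidal.μ_δ, Category.comp_id]

variable {V : C} {V' : D} (β : F.obj V ≅ V')

/-- The isomorphism `F(V^{⊗m}) ≅ V'^{⊗m}` induced by `β : F V ≅ V'` and the tensor structure of
`F`. -/
def mapTensorPowIso : (m : ℕ) → (F.obj (tensorPow V m) ≅ tensorPow V' m)
  | 0 => (Functor.Monoidal.εIso F).symm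
  | m + 1 => (Functor.Monoidal.μIso F V (tensorPow V m)).symm ≪≫ (β ⊗ᵢ mapTensorPowIso m)

theorem map_tensorPowShift (m : ℕ) :
    F.map (tensorPowShift V m).hom ≫ δ F _ _ ≫ (β.hom ⊗ₘ (mapTensorPowIso F β m).hom) =
      δ F _ _ ≫ ((mapTensorPowIso F β m).hom ⊗ₘ β.hom) ≫ (tensorPowShift V' m).hom := by
  induction m with
  | zero =>
    simp only [tensorPow, tensorPowShift, mapTensorPowIso, Iso.trans_hom, Iso.symm_hom,
      Functor.map_comp, Functor.Monoidal.map_rightUnitor_inv, Functor.Monoidal.map_leftUnitor,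
      Functor.Monoidal.εIso_inv, Category.assoc, Functor.Monoidal.μ_δ_assoc,
      MonoidalCategory.tensorHom_def]
    rw [whisker_exchange_assoc]
    simp
  | succ m ih =>
    simp only [tensorPow, tensorPowShift, mapTensorPowIso, Iso.trans_hom, Iso.symm_hom,
      Functor.map_comp, Functor.Monoidal.map_associator, whiskerLeftIso_hom,
      Functor.Monoidal.μIso_inv, Functor.Monoidal.map_whiskerLeft,
      Category.assoc, Functor.Monoidal.μ_δ_assoc, tensorIso_hom]
    rw [MonoidalCategory.tensorHom_def' β.hom, ← MonoidalCategory.whiskerLeft_comp_assoc _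
      (F.map (tensorPowShift V m).hom), ih]
    simp only [MonoidalCategory.whiskerLeft_comp, Category.assoc,
      Functor.Monoidal.whiskerLeft_μ_δ_assoc]
    rw [whisker_exchange, ← MonoidalCategory.tensorHom_def'_assoc, ← associator_naturality_assoc]
    simp only [MonoidalCategory.tensorHom_def, comp_whiskerRight, Category.assoc]

end Functor

/-! ### The rotation as a linear endomorphism -/

section Linear

variable {C : Type u} [Category.{v} C] [MonoidalCategory C] [Preadditive C]
  [MonoidalPreadditive C] [Linear ℂ C] [MonoidalLinear ℂ C]

/-- The rotation of `Hom(𝟙, V^{⊗(m+1)})` by a coevaluation `η : 𝟙 ⟶ X ⊗ V` and an evaluation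
`ε : X ⊗ V ⟶ 𝟙`. -/
def rotateEnd {V X : C} (η : 𝟙_ C ⟶ X ⊗ V) (ε : X ⊗ V ⟶ 𝟙_ C) (m : ℕ) :
    (𝟙_ C ⟶ V ⊗ tensorPow V m) →ₗ[ℂ] (𝟙_ C ⟶ V ⊗ tensorPow V m) where
  toFun f := rotateHom η ε f ≫ (tensorPowShift V m).hom
  map_add' f g := by
    simp only [rotateHom, MonoidalPreadditive.whiskerLeft_add,
      MonoidalPreadditive.add_whiskerRight, Preadditive.add_comp, Preadditive.comp_add]
  map_smul' c f := by
    simp only [rotateHom, MonoidalLinear.whiskerLeft_smul, MonoidalLinear.smul_whiskerRight,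
      Linear.smul_comp, Linear.comp_smul, RingHom.id_apply]

theorem rotateEnd_apply {V X : C} (η : 𝟙_ C ⟶ X ⊗ V) (ε : X ⊗ V ⟶ 𝟙_ C) (m : ℕ)
    (f : 𝟙_ C ⟶ V ⊗ tensorPow V m) :
    rotateEnd η ε m f = rotateHom η ε f ≫ (tensorPowShift V m).hom :=
  rfl

theorem rotateEnd_smul {V X : C} (c : ℂ) (η : 𝟙_ C ⟶ X ⊗ V) (ε : X ⊗ V ⟶ 𝟙_ C) (m : ℕ) :
    rotateEnd (c • η) ε m = c • rotateEnd η ε m := by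
  ext f
  simp [rotateEnd, rotateHom]

theorem rotateEnd_congr {V X X' : C} (γ : X ≅ X') (η : 𝟙_ C ⟶ X ⊗ V) (ε : X' ⊗ V ⟶ 𝟙_ C)
    (m : ℕ) : rotateEnd (η ≫ γ.hom ▷ V) ε m = rotateEnd η (γ.hom ▷ V ≫ ε) m := by
  ext f
  rw [rotateEnd_apply, rotateEnd_apply, rotateHom_congr]

theorem rotation_eq_rotateEnd [RightRigidCategory C] (j : PivotalStructure C) (V : C) (m : ℕ) :
    rotation j V m = rotateEnd (coev (dual V) ≫ dual V ◁ (j.app V).inv) (ev V) m := by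
  ext f
  rw [rotateEnd_apply, ← homD_comp_whiskerLeft, Category.assoc]
  rfl

variable {D : Type u₂} [Category.{v₂} D] [MonoidalCategory D] [Preadditive D]
  [MonoidalPreadditive D] [Linear ℂ D] [MonoidalLinear ℂ D]
  (F : C ⥤ D) [F.Monoidal] [F.Additive] [F.Linear ℂ] [F.Full] [F.Faithful]

/-- The isomorphism `Hom(𝟙, X) ≅ Hom(𝟙, Y)` induced by a fully faithful monoidal functor `F` and
an isomorphism `F X ≅ Y`. -/
def homUnitEquiv {X : C} {Y : D} (θ : F.obj X ≅ Y) : (𝟙_ C ⟶ X) ≃ₗ[ℂ] (𝟙_ D ⟶ Y) :=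
  LinearEquiv.ofBijective
    { toFun f := ε F ≫ F.map f ≫ θ.hom
      map_add' f g := by simp
      map_smul' c f := by simp }
    ⟨fun f g h => F.map_injective ((cancel_epi (ε F)).1 (by simpa using h)),
      fun g => ⟨F.preimage (η F ≫ g ≫ θ.inv), by simp⟩⟩

/-- The trace of the rotation is unchanged when `V` is replaced by `V' ≅ F V`, with the images under
`F` of the coevaluation and the evaluation. -/
theorem trace_rotateEnd_map {V X : C} {V' : D} (β : F.obj V ≅ V') (c : 𝟙_ C ⟶ X ⊗ V)
    (e : X ⊗ V ⟶ 𝟙_ C) (m : ℕ) :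
    LinearMap.trace ℂ _ (rotateEnd ((ε F ≫ F.map c ≫ δ F X V) ≫ F.obj X ◁ β.hom)
      (F.obj X ◁ β.inv ≫ μ F X V ≫ F.map e ≫ η F) m) = LinearMap.trace ℂ _ (rotateEnd c e m) := by
  let T : (𝟙_ C ⟶ V ⊗ tensorPow V m) ≃ₗ[ℂ] (𝟙_ D ⟶ V' ⊗ tensorPow V' m) :=
    homUnitEquiv F (mapTensorPowIso F β (m + 1))
  have hT (f) : T f = (ε F ≫ F.map f ≫ δ F V (tensorPow V m)) ≫
      (β.hom ⊗ₘ (mapTensorPowIso F β m).hom) := by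
    simp only [Category.assoc]
    rfl
  -- `T` intertwines the two rotations.
  rw [← LinearMap.trace_conj' _ T]
  congr 1
  ext g
  obtain ⟨f, rfl⟩ := T.surjective g
  rw [LinearEquiv.conj_apply_apply, LinearEquiv.symm_apply_apply, hT, hT]
  rw [rotateEnd_apply, rotateEnd_apply, rotateHom_comp_tensorHom, map_rotateHom]
  simp only [Category.assoc, Functor.map_comp, map_tensorPowShift]

end Linear

/-! ### Independence of the pairings and invariance under equivalences -/

section Fusion

variable {C : Type u} [Category.{v} C] [Abelian C] [Linear ℂ C] [MonoidalCategory C]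
  [MonoidalPreadditive C] [MonoidalLinear ℂ C] [RigidCategory C] [FusionCategory C]

/-- Schur's lemma. -/
theorem exists_eq_smul_id {V : C} (hV : Simple V) (f : V ⟶ V) : ∃ c : ℂ, f = c • 𝟙 V := by
  let e := (FusionCategory.end_simple V hV).some
  refine ⟨e f, e.injective ?_⟩
  change e f = e (e f • (1 : End V))
  rw [map_smul, map_one, smul_eq_mul, mul_one]

theorem unitScalar_smul (c : ℂ) (f : 𝟙_ C ⟶ 𝟙_ C) :
    unitScalar (c • f : 𝟙_ C ⟶ 𝟙_ C) = c * unitScalar f :=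
  map_smul (FusionCategory.end_simple (𝟙_ C) FusionCategory.simple_unit).some c (f : End (𝟙_ C))

theorem unitScalar_id : unitScalar (𝟙 (𝟙_ C)) = 1 :=
  map_one (FusionCategory.end_simple (𝟙_ C) FusionCategory.simple_unit).some

/-- The trace of the rotation of `Hom(𝟙, V^{⊗(m+1)})` multiplied by the dimension of `V`, both
computed with the pairings `p` of `V` with `X` and `q` of `X` with `V`. -/
def pairingIndicator {V X : C} (p : ExactPairing V X) (q : ExactPairing X V) (m : ℕ) : ℂ :=
  LinearMap.trace ℂ _ (rotateEnd q.coevaluation' p.evaluation' m) *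
    unitScalar (p.coevaluation' ≫ q.evaluation' : 𝟙_ C ⟶ 𝟙_ C)

/-- For simple `V`, the number `pairingIndicator p q` depends only on `V`. -/
theorem pairingIndicator_eq {V X X' : C} (hV : Simple V) (p : ExactPairing V X)
    (q : ExactPairing X V) (p' : ExactPairing V X') (q' : ExactPairing X' V) (m : ℕ) :
    pairingIndicator p q m = pairingIndicator p' q' m := by
  -- `r` is `q` carried over to `X'`, so that `r` and `q'` exhibit `V` as a dual of `X'` twice.
  let γ := rightDualIso p p'
  let r : ExactPairing X' V := @exactPairingCongrLeft _ _ _ X' X V q γ.symm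
  let ψ := rightDualIso r q'
  obtain ⟨c, hc⟩ := exists_eq_smul_id hV ψ.hom
  have h₁ : q'.coevaluation' = c • (q.coevaluation' ≫ γ.hom ▷ V) := by
    rw [← coevaluation_comp_rightDualIso r q']
    change r.coevaluation' ≫ X' ◁ ψ.hom = _
    rw [hc, MonoidalLinear.whiskerLeft_smul, MonoidalCategory.whiskerLeft_id, Linear.comp_smul,
      Category.comp_id]
    rfl
  have h₂ : V ◁ γ.inv ≫ q.evaluation' = c • q'.evaluation' := by
    change r.evaluation' = _
    rw [← rightDualIso_comp_evaluation r q']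
    change ψ.hom ▷ X' ≫ _ = _
    rw [hc, MonoidalLinear.smul_whiskerRight, id_whiskerRight, Linear.smul_comp,
      Category.id_comp]
  have h₃ : p.coevaluation' ≫ q.evaluation' = c • (p'.coevaluation' ≫ q'.evaluation') := by
    rw [← Linear.comp_smul, ← h₂, ← coevaluation_comp_rightDualIso p p']
    simp [γ]
  rw [pairingIndicator, pairingIndicator, h₁, h₃, rotateEnd_smul, rotateEnd_congr,
    rightDualIso_comp_evaluation, map_smul, smul_eq_mul, unitScalar_smul]
  ring

/-- A pivotal structure enters the product `ν_n(V) pdim(V)` only through the pairing of `V*` with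
`V` that `j_V : V ≅ V**` induces. -/
theorem indicator_mul_pdim_eq_pairingIndicator (j : PivotalStructure C) (V : C) (n : ℕ+) :
    indicator j n V * pdim j V =
      pairingIndicator (RightRigidCategory.rightDual V).exact
        (@exactPairingCongrRight _ _ _ (dual V) V _ (RightRigidCategory.rightDual (dual V)).exact
          (j.app V)) n.natPred := by
  rw [pairingIndicator, indicator, rotation_eq_rotateEnd, pdim, ptrace, Category.id_comp]
  rfl

variable {D : Type u₂} [Category.{v₂} D] [Abelian D] [Linear ℂ D] [MonoidalCategory D]
  [MonoidalPreadditive D] [MonoidalLinear ℂ D] [RigidCategory D] [FusionCategory D]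
  (F : C ⥤ D) [F.Monoidal] [F.Linear ℂ]

theorem unitScalar_map (f : 𝟙_ C ⟶ 𝟙_ C) :
    unitScalar (ε F ≫ F.map f ≫ η F : 𝟙_ D ⟶ 𝟙_ D) = unitScalar f := by
  obtain ⟨c, rfl⟩ := exists_eq_smul_id (FusionCategory.simple_unit (C := C)) f
  have h : ε F ≫ F.map (c • 𝟙 (𝟙_ C)) ≫ η F = c • 𝟙 (𝟙_ D) := by simp
  rw [h, unitScalar_smul, unitScalar_smul, unitScalar_id, unitScalar_id]

variable [F.Additive] [F.Full] [F.Faithful]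

theorem pairingIndicator_map {V X : C} {V' : D} (β : F.obj V ≅ V') (p : ExactPairing V X)
    (q : ExactPairing X V) (m : ℕ) :
    pairingIndicator (@exactPairingCongrLeft _ _ _ V' _ _ (mapExactPairing F p) β.symm)
      (@exactPairingCongrRight _ _ _ _ V' _ (mapExactPairing F q) β.symm) m =
      pairingIndicator p q m := by
  rw [pairingIndicator, pairingIndicator]
  congr 1
  · exact trace_rotateEnd_map F β _ _ m
  · rw [← unitScalar_map F]
    congr 1
    change ((ε F ≫ F.map p.coevaluation' ≫ δ F V X) ≫ β.hom ▷ _) ≫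
      (β.inv ▷ _ ≫ μ F V X ≫ F.map q.evaluation' ≫ η F) = _
    simp only [Category.assoc, hom_inv_whiskerRight_assoc, Functor.Monoidal.δ_μ_assoc,
      Functor.map_comp]

/-- The summands for a simple object `V'` and for an object `V` with `F V ≅ V'` agree, for arbitrary
pivotal structures. -/
theorem indicator_mul_pdim_eq (jC : PivotalStructure C) (jD : PivotalStructure D) {V : C} {V' : D}
    (hV' : Simple V') (β : F.obj V ≅ V') (n : ℕ+) :
    indicator jC n V * pdim jC V = indicator jD n V' * pdim jD V' := by
  rw [indicator_mul_pdim_eq_pairingIndicator, indicator_mul_pdim_eq_pairingIndicator,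
    ← pairingIndicator_map F β]
  exact pairingIndicator_eq hV' _ _ _ _ _

end Fusion

/-! ### Isomorphism classes of simple objects -/

section Irr

variable {C : Type u} [Category.{v} C] [Abelian C]

/-- The isomorphism class of a simple object. -/
def Irr.mk (V : C) (hV : Simple V) : Irr C :=
  ⟨Quotient.mk _ V, (Simple.iff_of_iso (Quotient.mk_out (s := isIsomorphicSetoid C) V).some).2 hV⟩

theorem Irr.nonempty_rep_mk_iso (V : C) (hV : Simple V) : Nonempty ((Irr.mk V hV).rep ≅ V) :=
  Quotient.mk_out (s := isIsomorphicSetoid C) V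

theorem Irr.simple_rep (c : Irr C) : Simple c.rep := c.2

theorem Irr.eq_of_iso {c d : Irr C} (i : c.rep ≅ d.rep) : c = d :=
  Subtype.ext (Quotient.out_equiv_out.1 ⟨i⟩)

variable {D : Type u₂} [Category.{v₂} D] [Abelian D] (F : C ⥤ D) [F.IsEquivalence]

/-- The map of isomorphism classes of simple objects induced by an equivalence of categories. -/
def Irr.map (c : Irr C) : Irr D :=
  haveI := c.simple_rep
  Irr.mk (F.obj c.rep) (simple_obj F _)

theorem Irr.nonempty_map_iso (c : Irr C) : Nonempty (F.obj c.rep ≅ (c.map F).rep) :=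
  ⟨(Irr.nonempty_rep_mk_iso _ _).some.symm⟩

theorem Irr.map_bijective : Function.Bijective (Irr.map F : Irr C → Irr D) := by
  refine ⟨fun c d h => ?_, fun d => ?_⟩
  · obtain ⟨i⟩ := c.nonempty_map_iso F
    obtain ⟨i'⟩ := d.nonempty_map_iso F
    exact Irr.eq_of_iso (F.preimageIso (i ≪≫ eqToIso (by rw [h]) ≪≫ i'.symm))
  · have i := F.objObjPreimageIso d.rep
    have := d.simple_rep
    have hV : Simple (F.objPreimage d.rep) := (simple_obj_iff F _).1 (Simple.of_iso i)
    refine ⟨Irr.mk _ hV, Irr.eq_of_iso ?_⟩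
    exact ((Irr.mk _ hV).nonempty_map_iso F).some.symm ≪≫
      F.mapIso (Irr.nonempty_rep_mk_iso _ hV).some ≪≫ i

end Irr

end

end FusionFS

theorem theorem3p1
    {C : Type*} [Category* C] [Abelian C] [Linear ℂ C] [MonoidalCategory C]
    [MonoidalPreadditive C] [MonoidalLinear ℂ C] [RigidCategory C] [FusionFS.FusionCategory C]
    {D : Type*} [Category* D] [Abelian D] [Linear ℂ D] [MonoidalCategory D]
    [MonoidalPreadditive D] [MonoidalLinear ℂ D] [RigidCategory D] [FusionFS.FusionCategory D]
    (jC : FusionFS.PivotalStructure C) (jD : FusionFS.PivotalStructure D)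
    (h : FusionFS.MonoidallyEquivalent C D) (n : ℕ+) :
    FusionFS.categoryIndicator jC n = FusionFS.categoryIndicator jD n := by
  obtain ⟨F, _, _, _, ⟨_⟩⟩ := h
  exact finsum_eq_of_bijective (FusionFS.Irr.map F) (FusionFS.Irr.map_bijective F) fun c =>
    FusionFS.indicator_mul_pdim_eq F jC jD (FusionFS.Irr.simple_rep _)
      (c.nonempty_map_iso F).some n
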